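/- Let $R$ be a commutative ring; sheaves are sheaves of $R$-modules, $D^+(X)$ and $D^b(X)$ denote the bounded below and the bounded derived category of sheaves on a space $X$. A stratification $\mathcal S$ of a topological space $X$ is a finite partition of $X$ into (nonempty) locally closed subsets, the strata, each of which is a simply connected topological manifold, such that the closure of every stratum is a union of strata. The set $\mathcal S$ of strata carries the final topology with respect to the projection $p\colon X\to\mathcal S$ that sends a point to the stratum containing it. The star of a stratum $A$ is the open set $\mathrm{St}(A)=\bigcup_{B\in\mathcal S,\ A\subset\overline B}B$. A sheaf on $X$ is weakly constructible if its restriction to every stratum is a constant sheaf, and $D^+_{w,c}(X)\subset D^+(X)$, $D^b_{w,c}(X)\subset D^b(X)$ are the full subcategories of complexes all of whose cohomology sheaves are weakly constructible. The stratification is called acyclic if for every weakly constructible sheaf $\mathcal F$ and every stratum $A$ (1) the natural map $\Gamma(\mathrm{St}(A),\mathcal F)\to\mathcal F_x$ is an isomorphism for every $x\in A$, and (2) $H^i(\mathrm{St}(A),\mathcal F)=0$ for all $i>0$. Let $\mathcal S$ be an acyclic stratification of a topological space $X$. Then the adjoint pair $p^*\colon D^+(\mathcal S)\rightleftarrows D^+(X)\colon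 Rp_*$ (with $p^*$ left adjoint to $Rp_*$) induces mutually quasi-inverse equivalences of categories $$D^+_{w,c}(X)\ \underset{p^*}{\overset{Rp_*}{\rightleftarrows}}\ D^+(\mathcal S),$$ that is, $p^*$ takes values in $D^+_{w,c}(X)$, and the unit $\mathrm{id}\to Rp_*p^*$ on $D^+(\mathcal S)$ and the counit $p^*Rp_*\to\mathrm{id}$ on $D^+_{w,c}(X)$ are isomorphisms. Moreover, these functors restrict to mutually quasi-inverse equivalences $$D^b_{w,c}(X)\ \underset{p^*}{\overset{Rp_*}{\rightleftarrows}}\ D^b(\mathcal S);$$ no further condition on $X$ is imposed here, so that this holds in particular if $X$ has finite homological dimension. -/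

import Mathlib

open CategoryTheory Limits TopologicalSpace Opposite

universe w w₁ w₂ v₁ v₂ v₃ v₄ u₁ u₂ u₃ u₄ u

noncomputable section

namespace CategoryTheory

/-! ### Equivalences induced by an adjunction -/

/-- Let `adj : G ⊣ F` be an adjunction between `C` and `D`, and let `iC : C' ⥤ C`, `iD : D' ⥤ D`
be (inclusions of) full subcategories. The adjoint pair `(G, F)` induces an equivalence
between `D'` and `C'` if there is an equivalence `e : D' ≌ C'` whose functor is the
restriction of `F`, whose inverse is the restriction of `G`, and whose structural isomorphisms
`𝟭 ≅ e.inverse ⋙ e.functor` and `e.functor ⋙ e.inverse ≅ 𝟭` are the restrictions of the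
unit and of the counit of `adj`. -/
def Adjunction.InducesEquivalence {C : Type u₁} [Category.{v₁} C] {D : Type u₂} [Category.{v₂} D]
    {C' : Type u₃} [Category.{v₃} C'] {D' : Type u₄} [Category.{v₄} D']
    {G : C ⥤ D} {F : D ⥤ C} (adj : G ⊣ F) (iC : C' ⥤ C) (iD : D' ⥤ D) : Prop :=
  ∃ (e : D' ≌ C') (α : e.inverse ⋙ iD ≅ iC ⋙ G) (β : e.functor ⋙ iC ≅ iD ⋙ F),
    (∀ X : C', iC.map (e.counitIso.inv.app X) ≫ β.hom.app (e.inverse.obj X) =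
      adj.unit.app (iC.obj X) ≫ F.map (α.inv.app X)) ∧
    (∀ Y : D', G.map (β.inv.app Y) ≫ α.inv.app (e.functor.obj Y) ≫ iD.map (e.unitIso.inv.app Y) =
      adj.counit.app (iD.obj Y))

/-! ### Derived adjunctions -/

section HomotopyCategory

variable {C : Type u₁} [Category.{v₁} C] [Preadditive C]
  {D : Type u₂} [Category.{v₂} D] [Preadditive D]
  {G : C ⥤ D} {F : D ⥤ C} [G.Additive] [F.Additive]

/-- An adjunction between additive functors, applied degreewise to complexes. -/
def Adjunction.mapCochainComplex (adj : G ⊣ F) :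
    G.mapHomologicalComplex (ComplexShape.up ℤ) ⊣ F.mapHomologicalComplex (ComplexShape.up ℤ) where
  unit :=
    { app := fun K =>
        { f := fun i => adj.unit.app (K.X i)
          comm' := fun i j _ => (adj.unit.naturality (K.d i j)).symm }
      naturality := fun K L f => by
        ext i
        exact adj.unit.naturality (f.f i) }
  counit :=
    { app := fun K =>
        { f := fun i => adj.counit.app (K.X i)
          comm' := fun i j _ => (adj.counit.naturality (K.d i j)).symm }
      naturality := fun K L f => by
        ext i
        exact adj.counit.naturality (f.f i) }
  left_triangle_components K := by
    ext i
    exact adj.left_triangle_components (K.X i)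
  right_triangle_components K := by
    ext i
    exact adj.right_triangle_components (K.X i)

/-- The adjunction between homotopy categories of complexes induced by
an adjunction between additive functors. -/
def Adjunction.mapHomotopyCategory (adj : G ⊣ F) :
    G.mapHomotopyCategory (ComplexShape.up ℤ) ⊣ F.mapHomotopyCategory (ComplexShape.up ℤ) where
  unit :=
    { app := fun K => (HomotopyCategory.quotient C _).map (adj.mapCochainComplex.unit.app K.as)
      naturality := by
        rintro ⟨K⟩ ⟨L⟩ f
        obtain ⟨f, rfl⟩ := (HomotopyCategory.quotient C _).map_surjective f
        exact congrArg (HomotopyCategory.quotient C _).map (adj.mapCochainComplex.unit.naturality f) }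
  counit :=
    { app := fun K => (HomotopyCategory.quotient D _).map (adj.mapCochainComplex.counit.app K.as)
      naturality := by
        rintro ⟨K⟩ ⟨L⟩ f
        obtain ⟨f, rfl⟩ := (HomotopyCategory.quotient D _).map_surjective f
        exact congrArg (HomotopyCategory.quotient D _).map
          (adj.mapCochainComplex.counit.naturality f) }
  left_triangle_components K :=
    congrArg (HomotopyCategory.quotient D _).map
      (adj.mapCochainComplex.left_triangle_components K.as)
  right_triangle_components K :=
    congrArg (HomotopyCategory.quotient C _).map
      (adj.mapCochainComplex.right_triangle_components K.as)

/-- The adjunction between homotopy categories of bounded below complexes induced by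
an adjunction between additive functors. -/
def Adjunction.mapHomotopyCategoryPlus (adj : G ⊣ F) :
    G.mapHomotopyCategoryPlus ⊣ F.mapHomotopyCategoryPlus :=
  adj.mapHomotopyCategory.restrictFullyFaithful
    (HomotopyCategory.Plus.fullyFaithfulι C) (HomotopyCategory.Plus.fullyFaithfulι D)
    (Iso.refl _) (Iso.refl _)

end HomotopyCategory

section DerivedCategory

variable {C : Type u₁} [Category.{v₁} C] [Abelian C] [HasDerivedCategory.{w₁} C]
  {D : Type u₂} [Category.{v₂} D] [Abelian D] [HasDerivedCategory.{w₂} D]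

/-- The functor `D⁺(C) ⥤ D⁺(D)` induced by an exact functor `G : C ⥤ D`. -/
def Functor.mapDerivedCategoryPlus (G : C ⥤ D) [G.Additive] [PreservesFiniteLimits G]
    [PreservesFiniteColimits G] : DerivedCategory.Plus C ⥤ DerivedCategory.Plus D :=
  (DerivedCategory.TStructure.t (C := D)).plus.lift
    (DerivedCategory.Plus.ι ⋙ G.mapDerivedCategory) (by
      rintro ⟨X, n, ⟨K, e, hK⟩⟩
      refine ⟨n, ⟨(G.mapHomologicalComplex _).obj K,
        G.mapDerivedCategory.mapIso e ≪≫ G.mapDerivedCategoryFactors.app K, ?_⟩⟩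
      infer_instance)

/-- The functor `G.mapDerivedCategoryPlus` is given by the degreewise application of `G`
to bounded below complexes. -/
def Functor.mapDerivedCategoryPlusFactorsh (G : C ⥤ D) [G.Additive] [PreservesFiniteLimits G]
    [PreservesFiniteColimits G] :
    DerivedCategory.Plus.Qh ⋙ G.mapDerivedCategoryPlus ≅
      G.mapHomotopyCategoryPlus ⋙ DerivedCategory.Plus.Qh :=
  ((DerivedCategory.TStructure.t (C := D)).plus.fullyFaithfulι.whiskeringRight _).preimageIso
    (Functor.isoWhiskerLeft (HomotopyCategory.Plus.ι C) G.mapDerivedCategoryFactorsh)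

/-- Let `adj : G ⊣ F` be an adjunction with `G : C ⥤ D` exact, and assume that `D` has enough
injectives. This is the induced adjunction `G ⊣ RF` between bounded below derived categories. -/
def Adjunction.derivedPlus {G : C ⥤ D} {F : D ⥤ C} [G.Additive] [F.Additive]
    [PreservesFiniteLimits G] [PreservesFiniteColimits G] [EnoughInjectives D] (adj : G ⊣ F) :
    G.mapDerivedCategoryPlus ⊣ F.rightDerivedFunctorPlus :=
  haveI : G.mapDerivedCategoryPlus.IsLeftDerivedFunctor G.mapDerivedCategoryPlusFactorsh.hom
      (HomotopyCategory.Plus.quasiIso C) :=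
    Functor.isLeftDerivedFunctor_of_inverts _ _ _
  haveI : (G.mapDerivedCategoryPlus ⋙ F.rightDerivedFunctorPlus).IsLeftDerivedFunctor
      ((Functor.associator _ _ _).inv ≫ Functor.whiskerRight G.mapDerivedCategoryPlusFactorsh.hom
        F.rightDerivedFunctorPlus) (HomotopyCategory.Plus.quasiIso C) :=
    Functor.isLeftDerivedFunctor_of_inverts _ _
      ((Functor.associator _ _ _).symm ≪≫ Functor.isoWhiskerRight G.mapDerivedCategoryPlusFactorsh
        F.rightDerivedFunctorPlus)
  haveI : (F.rightDerivedFunctorPlus ⋙ G.mapDerivedCategoryPlus).IsRightDerivedFunctor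
      (Functor.whiskerRight F.rightDerivedFunctorPlusUnit G.mapDerivedCategoryPlus ≫
        (Functor.associator _ _ _).hom) (HomotopyCategory.Plus.quasiIso D) :=
    (HomotopyCategory.Plus.localizerMorphism_derives _).isRightDerivedFunctor_of_isIso _
      (fun K => by
        dsimp
        infer_instance)
  adj.mapHomotopyCategoryPlus.derived (HomotopyCategory.Plus.quasiIso C)
    (HomotopyCategory.Plus.quasiIso D) G.mapDerivedCategoryPlusFactorsh.hom
    F.rightDerivedFunctorPlusUnit

end DerivedCategory

end CategoryTheory

/-- The inclusion of the bounded derived category in the bounded below derived category. -/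
abbrev DerivedCategory.boundedToPlus (C : Type u₁) [Category.{v₁} C] [Abelian C]
    [HasDerivedCategory.{w} C] : DerivedCategory.Bounded C ⥤ DerivedCategory.Plus C :=
  ObjectProperty.ιOfLE (fun _ h => h.1)

/-! ### Stratified spaces -/

/-- A topological manifold: a Hausdorff second countable space which is locally homeomorphic
to some `ℝⁿ`. -/
def IsTopologicalManifold (M : Type u) [TopologicalSpace M] : Prop :=
  T2Space M ∧ SecondCountableTopology M ∧
    ∃ n : ℕ, Nonempty (ChartedSpace (EuclideanSpace ℝ (Fin n)) M)

/-- A (finite) stratification of a topological space: a finite partition into locally closed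
subsets which are simply connected topological manifolds, such that the closure of any
stratum is a union of strata. -/
structure Stratification (X : TopCat.{u}) where
  /-- the set of strata -/
  strata : Set (Set X)
  finite : strata.Finite
  isPartition : Setoid.IsPartition strata
  isTopologicalManifold : ∀ A ∈ strata, IsTopologicalManifold A
  simplyConnected : ∀ A ∈ strata, SimplyConnectedSpace A
  isLocallyClosed : ∀ A ∈ strata, IsLocallyClosed A
  closure_eq : ∀ A ∈ strata, ∃ T ⊆ strata, closure A = ⋃₀ T

namespace Stratification

variable {X : TopCat.{u}} (S : Stratification X)

/-- The type of strata. -/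
def Stratum : Type u := {A : Set X // A ∈ S.strata}

/-- The map which sends a point to the stratum that contains it. -/
def toStratum (x : X) : S.Stratum :=
  ⟨(S.isPartition.2 x).choose, (S.isPartition.2 x).choose_spec.1.1⟩

lemma mem_toStratum (x : X) : x ∈ (S.toStratum x).1 :=
  (S.isPartition.2 x).choose_spec.1.2

lemma eq_of_mem {A B : Set X} (hA : A ∈ S.strata) (hB : B ∈ S.strata) {x : X}
    (hxA : x ∈ A) (hxB : x ∈ B) : A = B :=
  (S.isPartition.2 x).unique ⟨hA, hxA⟩ ⟨hB, hxB⟩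

/-- The set of strata is endowed with the final topology for the projection `X → S`. -/
instance : TopologicalSpace S.Stratum := TopologicalSpace.coinduced S.toStratum inferInstance

/-- The space of strata. -/
abbrev space : TopCat.{u} := TopCat.of S.Stratum

/-- The projection `p : X ⟶ S`. -/
def proj : X ⟶ S.space := TopCat.ofHom ⟨S.toStratum, continuous_coinduced_rng⟩

/-- The inclusion of a stratum. -/
def incl (A : S.Stratum) : TopCat.of A.1 ⟶ X := TopCat.ofHom ⟨Subtype.val, continuous_subtype_val⟩

lemma subset_closure_of_mem {A B : Set X} (hA : A ∈ S.strata) (hB : B ∈ S.strata) {x : X}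
    (hxA : x ∈ A) (hx : x ∈ closure B) : A ⊆ closure B := by
  obtain ⟨T, hT, h⟩ := S.closure_eq B hB
  rw [h] at hx ⊢
  obtain ⟨A', hA', hxA'⟩ := hx
  obtain rfl := S.eq_of_mem hA (hT hA') hxA hxA'
  exact Set.subset_sUnion_of_mem hA'

/-- The star of a stratum `A`: the union of all strata whose closure contains `A`. -/
def star (A : S.Stratum) : Opens X where
  carrier := ⋃₀ {B | B ∈ S.strata ∧ A.1 ⊆ closure B}
  is_open' := by
    rw [← isClosed_compl_iff]
    have : (⋃₀ {B | B ∈ S.strata ∧ A.1 ⊆ closure B})ᶜ =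
        ⋃₀ (closure '' {B | B ∈ S.strata ∧ ¬ A.1 ⊆ closure B}) := by
      ext x
      constructor
      · intro hx
        refine ⟨_, ⟨(S.toStratum x).1, ⟨(S.toStratum x).2, fun h => hx ?_⟩, rfl⟩,
          subset_closure (S.mem_toStratum x)⟩
        exact ⟨_, ⟨(S.toStratum x).2, h⟩, S.mem_toStratum x⟩
      · rintro ⟨_, ⟨B, ⟨hB, hAB⟩, rfl⟩, hx⟩ ⟨B', ⟨hB', hAB'⟩, hx'⟩
        exact hAB (hAB'.trans (closure_minimal (S.subset_closure_of_mem hB' hB hx' hx)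
          isClosed_closure))
    rw [this, Set.sUnion_image]
    exact (S.finite.subset fun B hB => hB.1).isClosed_biUnion fun _ _ => isClosed_closure

lemma subset_star (A : S.Stratum) {x : X} (hx : x ∈ A.1) : x ∈ S.star A :=
  ⟨A.1, ⟨A.2, subset_closure⟩, hx⟩

end Stratification

/-! ### Sheaves of modules -/

/-- Sheaves of `R`-modules on `X`. -/
abbrev ModSheaf (R : Type u) [CommRing R] (X : TopCat.{u}) := TopCat.Sheaf (ModuleCat.{u} R) X

namespace ModSheaf

variable (R : Type u) [CommRing R] {X Y : TopCat.{u}}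

/-- The inverse image functor `f^*`. -/
abbrev pullback (f : X ⟶ Y) : ModSheaf R Y ⥤ ModSheaf R X :=
  TopCat.Sheaf.pullback (ModuleCat.{u} R) f

/-- The direct image functor `f_*`. -/
abbrev pushforward (f : X ⟶ Y) : ModSheaf R X ⥤ ModSheaf R Y :=
  TopCat.Sheaf.pushforward (ModuleCat.{u} R) f

/-- The adjunction `f^* ⊣ f_*`. -/
abbrev adjunction (f : X ⟶ Y) : pullback R f ⊣ pushforward R f :=
  TopCat.Sheaf.pullbackPushforwardAdjunction (ModuleCat.{u} R) f

instance (f : X ⟶ Y) : (pushforward R f).Additive where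

instance (f : X ⟶ Y) : (pullback R f).Additive := (adjunction R f).left_adjoint_additive

instance (f : X ⟶ Y) : PreservesFiniteLimits (pullback R f) :=
  Functor.SmallCategories.instPreservesFiniteLimitsSheafSheafPullbackOfRepresentablyFlat
    (Opens.map f) (ModuleCat.{u} R) (Opens.grothendieckTopology Y) (Opens.grothendieckTopology X)

instance (f : X ⟶ Y) : PreservesFiniteColimits (pullback R f) :=
  have := (adjunction R f).leftAdjoint_preservesColimits
  inferInstance

/-- The functor `Γ(U, -)`. -/
def sections (U : Opens X) : ModSheaf R X ⥤ ModuleCat.{u} R :=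
  TopCat.Sheaf.forget _ X ⋙ (evaluation _ _).obj (op U)

instance (U : Opens X) : (sections R U).Additive where

variable {R}

/-- The sheaf cohomology `Hⁱ(U, F)` of an open subset, as the `i`th right derived functor
of `Γ(U, -)`. -/
def cohomology (F : ModSheaf R X) (U : Opens X) (i : ℕ) : ModuleCat.{u} R :=
  ((sections R U).rightDerived i).obj F

/-- A sheaf is constant if it is isomorphic to the constant sheaf attached to some module. -/
def IsConstant (F : ModSheaf R X) : Prop :=
  CategoryTheory.Sheaf.IsConstant (Opens.grothendieckTopology X) F

end ModSheaf

/-! ### Weakly constructible sheaves and acyclic stratifications -/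

namespace Stratification

variable {X : TopCat.{u}} (S : Stratification X) (R : Type u) [CommRing R]

/-- A sheaf is weakly constructible if its restriction to every stratum is constant. -/
def weaklyConstructible : ObjectProperty (ModSheaf R X) := fun F =>
  ∀ A : S.Stratum, ((ModSheaf.pullback R (S.incl A)).obj F).IsConstant

/-- A sheaf `F` is `S`-acyclic if `Hⁱ(star A, F) = 0` for every stratum `A` and every `i > 0`. -/
def IsAcyclicSheaf (F : ModSheaf R X) : Prop :=
  ∀ (A : S.Stratum) (i : ℕ), 0 < i → IsZero (F.cohomology (S.star A) i)

/-- Acyclic stratifications (with respect to the base ring `R`). -/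
structure IsAcyclic : Prop where
  isIso_germ : ∀ F : ModSheaf R X, S.weaklyConstructible R F →
    ∀ (A : S.Stratum) (x : X) (hx : x ∈ A.1),
      IsIso (F.presheaf.germ (S.star A) x (S.subset_star A hx))
  isAcyclicSheaf : ∀ F : ModSheaf R X, S.weaklyConstructible R F → S.IsAcyclicSheaf R F

section

variable [HasDerivedCategory.{w₁} (ModSheaf R X)]

/-- The property of objects of `D⁺(X)` defining `D⁺_{w,c}(X)`: all the cohomology sheaves are
weakly constructible. -/
def weaklyConstructiblePlus : ObjectProperty (DerivedCategory.Plus (ModSheaf R X)) := fun K =>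
  ∀ n : ℤ, S.weaklyConstructible R ((DerivedCategory.homologyFunctor (ModSheaf R X) n).obj K.obj)

/-- The property of objects of `Dᵇ(X)` defining `Dᵇ_{w,c}(X)`: all the cohomology sheaves are
weakly constructible. -/
def weaklyConstructibleBounded : ObjectProperty (DerivedCategory.Bounded (ModSheaf R X)) :=
  fun K =>
    ∀ n : ℤ, S.weaklyConstructible R ((DerivedCategory.homologyFunctor (ModSheaf R X) n).obj K.obj)

variable [HasDerivedCategory.{w₂} (ModSheaf R S.space)]

/-- The functor `p^* : D⁺(S) ⥤ D⁺(X)`. -/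
abbrev pullbackPlus :
    DerivedCategory.Plus (ModSheaf R S.space) ⥤ DerivedCategory.Plus (ModSheaf R X) :=
  (ModSheaf.pullback R S.proj).mapDerivedCategoryPlus

/-- The functor `Rp_* : D⁺(X) ⥤ D⁺(S)`. -/
abbrev derivedPushforwardPlus :
    DerivedCategory.Plus (ModSheaf R X) ⥤ DerivedCategory.Plus (ModSheaf R S.space) :=
  (ModSheaf.pushforward R S.proj).rightDerivedFunctorPlus

/-- The adjunction `p^* ⊣ Rp_*` between `D⁺(S)` and `D⁺(X)`, induced by `p^* ⊣ p_*`. -/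
abbrev derivedAdjunction : S.pullbackPlus R ⊣ S.derivedPushforwardPlus R :=
  (ModSheaf.adjunction R S.proj).derivedPlus

end

end Stratification

end

/-!
Let `p : X ⟶ S` be the projection to the finite space of strata. Every `A ∈ S` has a smallest open
neighborhood, whose preimage is the star of `A`; hence the stalk of `p_* F` at `A` is
`Γ(star A, F)`. If sections over stars are the same as germs, then the unit `G ⟶ p_* p^* G` is
an isomorphism on stalks, as `p^* G` has the same stalks as `G`. By a triangle identity `p_*` maps
the counit at a weakly constructible sheaf `F` to an isomorphism, and `p^* p_* F` is weakly
constructible as well, so that the counit is an isomorphism on stalks.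

To pass to complexes, note that the sheaves without higher cohomology on stars contain the
injective sheaves, are stable under extensions and cokernels of monomorphisms, and that `p_*` is
exact on short exact sequences of such sheaves. It follows that `p_*` computes `Rp_*` on bounded
below complexes of such sheaves, for example `p^* K`, and that `p_*` commutes with the cohomology of
such complexes when their cohomology sheaves are also of this kind. The unit is thus a termwise
isomorphism, and the counit is computed on cohomology after an injective resolution.
-/

noncomputable section

section AdaptedClasses

variable {C : Type u₁} [Category.{v₁} C] [Abelian C] {D : Type u₂} [Category.{v₂} D]

lemma shortExact_imageι {S : ShortComplex C} (hS : S.Exact) [Epi S.g]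
    (w : image.ι S.f ≫ S.g = 0) : (ShortComplex.mk (image.ι S.f) S.g w).ShortExact where
  exact :=
    let φ : S ⟶ ShortComplex.mk (image.ι S.f) S.g w :=
      { τ₁ := factorThruImage S.f, τ₂ := 𝟙 _, τ₃ := 𝟙 _ }
    (ShortComplex.exact_iff_of_epi_of_isIso_of_mono φ).1 hS
  mono_f := inferInstanceAs (Mono (image.ι S.f))
  epi_g := inferInstanceAs (Epi S.g)

lemma imageι_comp_eq_zero {X Y Z : C} {f : X ⟶ Y} {p : Y ⟶ Z} (w : f ≫ p = 0) :
    image.ι f ≫ p = 0 := by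
  rw [← cancel_epi (factorThruImage f), image.fac_assoc, w, comp_zero]

lemma preservesColimit_parallelPair_of_epi_map [Abelian D] (T : C ⥤ D) [T.Additive]
    [PreservesFiniteLimits T] {X Y Z : C} {f : X ⟶ Y} {p : Y ⟶ Z} {w : f ≫ p = 0}
    (hp : IsColimit (CokernelCofork.ofπ p w))
    [Epi (T.map (factorThruImage f))] [Epi (T.map p)] :
    PreservesColimit (parallelPair f 0) T := by
  have : Epi p := ⟨fun _ _ h ↦ Cofork.IsColimit.hom_ext hp h⟩
  have hS : (ShortComplex.mk (image.ι f) p (imageι_comp_eq_zero w)).ShortExact :=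
    shortExact_imageι (ShortComplex.exact_of_g_is_cokernel (.mk f p w) hp) _
  have hTS : ((ShortComplex.mk (image.ι f) p (imageι_comp_eq_zero w)).map T).ShortExact :=
    { exact := (T.preservesFiniteLimits_iff_forall_exact_map_and_mono.1 inferInstance _ hS).1
      mono_f := inferInstanceAs (Mono (T.map (image.ι f)))
      epi_g := inferInstanceAs (Epi (T.map p)) }
  refine preservesColimit_of_preserves_colimit_cocone hp
    ((CokernelCofork.isColimitMapCoconeEquiv _ T).symm ?_)
  have hfac : T.map f = T.map (factorThruImage f) ≫ T.map (image.ι f) := by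
    rw [← T.map_comp, image.fac]
  exact isCokernelEpiComp (f := T.map (image.ι f)) (c := CokernelCofork.ofπ (T.map p) _)
    hTS.gIsCokernel (T.map (factorThruImage f)) hfac

section Complexes

variable {ι : Type*} {c : ComplexShape ι} (K : HomologicalComplex C c)

lemma iCycles_comp_factorThruImage_toCycles (i j : ι) :
    K.iCycles i ≫ factorThruImage (K.toCycles i j) = 0 := by
  rw [← cancel_mono (image.ι _), ← cancel_mono (K.iCycles j)]
  simp

lemma shortExact_iCycles_factorThruImage_toCycles {i j : ι} (hij : c.next i = j) :
    (ShortComplex.mk _ _ (iCycles_comp_factorThruImage_toCycles K i j)).ShortExact where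
  exact :=
    let φ : ShortComplex.mk _ _ (iCycles_comp_factorThruImage_toCycles K i j) ⟶
        ShortComplex.mk _ _ (K.iCycles_d i j) :=
      { τ₁ := 𝟙 _, τ₂ := 𝟙 _, τ₃ := image.ι _ ≫ K.iCycles j }
    (ShortComplex.exact_iff_of_epi_of_isIso_of_mono φ).2
      (ShortComplex.exact_of_f_is_kernel _ (K.cyclesIsKernel i j hij))
  mono_f := inferInstanceAs (Mono (K.iCycles i))
  epi_g := inferInstanceAs (Epi (factorThruImage (K.toCycles i j)))

lemma shortExact_imageι_toCycles_homologyπ {i j : ι} (hij : c.prev j = i) :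
    (ShortComplex.mk (image.ι (K.toCycles i j)) (K.homologyπ j)
      (imageι_comp_eq_zero (K.toCycles_comp_homologyπ i j))).ShortExact :=
  shortExact_imageι (S := .mk _ _ (K.toCycles_comp_homologyπ i j))
    (ShortComplex.exact_of_g_is_cokernel _ (K.homologyIsCokernel i j hij)) _

lemma preservesLeftHomologyOf_sc_of_epi_map [Abelian D] (T : C ⥤ D) [T.Additive]
    [PreservesFiniteLimits T] (i : ι) [Epi (T.map (factorThruImage (K.toCycles (c.prev i) i)))]
    [Epi (T.map (K.homologyπ i))] : T.PreservesLeftHomologyOf (K.sc i) := by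
  have h : (K.sc i).leftHomologyData.f' = K.toCycles (c.prev i) i :=
    (cancel_mono (K.iCycles i)).1
      ((K.sc i).leftHomologyData.f'_i.trans (K.toCycles_i (c.prev i) i).symm)
  have hcoker : PreservesColimit (parallelPair (K.toCycles (c.prev i) i) 0) T :=
    preservesColimit_parallelPair_of_epi_map T (K.homologyIsCokernel (c.prev i) i rfl)
  have : (K.sc i).leftHomologyData.IsPreservedBy T :=
    { g := inferInstance
      f' := h ▸ hcoker }
  exact .mk' _ (K.sc i).leftHomologyData

end Complexes

/-- A class `P` of objects adapted to a left exact functor `T`: it contains the injective objects,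
it is closed under extensions and under cokernels of monomorphisms, and `T` is exact on the short
exact sequences whose first term belongs to it. Bounded below complexes in `P` compute the
right derived functor of `T`. -/
structure IsAdaptedTo (P : ObjectProperty C) (T : C ⥤ D) : Prop where
  of_injective (I : C) [Injective I] : P I
  extension {S : ShortComplex C} (hS : S.ShortExact) (h₁ : P S.X₁) (h₃ : P S.X₃) : P S.X₂
  cokernel {S : ShortComplex C} (hS : S.ShortExact) (h₁ : P S.X₁) (h₂ : P S.X₂) : P S.X₃
  epi_map {S : ShortComplex C} (hS : S.ShortExact) (h₁ : P S.X₁) : Epi (T.map S.g)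

namespace IsAdaptedTo

variable {P : ObjectProperty C} {T : C ⥤ D}

lemma comp {E : Type u₃} [Category.{v₃} E] (hP : IsAdaptedTo P T) (G : D ⥤ E)
    [G.PreservesEpimorphisms] :
    IsAdaptedTo P (T ⋙ G) where
  of_injective := hP.of_injective
  extension := hP.extension
  cokernel := hP.cokernel
  epi_map hS h₁ :=
    have := hP.epi_map hS h₁
    inferInstanceAs (Epi (G.map (T.map _)))

lemma of_isZero (hP : IsAdaptedTo P T) {X : C} (hX : IsZero X) : P X :=
  have := hX.injective
  hP.of_injective X

open ZeroObject in
lemma of_iso (hP : IsAdaptedTo P T) {X Y : C} (e : X ≅ Y) (hX : P X) : P Y :=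
  hP.cokernel (S := .mk (0 : 0 ⟶ X) e.hom zero_comp)
    { exact := (ShortComplex.exact_iff_mono _ rfl).2 (inferInstanceAs (Mono e.hom))
      mono_f := inferInstanceAs (Mono (0 : 0 ⟶ X))
      epi_g := inferInstanceAs (Epi e.hom) }
    (hP.of_isZero (isZero_zero C)) hX

lemma biprod (hP : IsAdaptedTo P T) {X Y : C} (hX : P X) (hY : P Y) : P (X ⊞ Y) :=
  hP.extension (S := .mk (biprod.inl : X ⟶ X ⊞ Y) biprod.snd biprod.inl_snd)
    (ShortComplex.Splitting.shortExact { r := biprod.fst, s := biprod.inr }) hX hY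

section

variable (hP : IsAdaptedTo P T) (K : CochainComplex C ℤ) (n : ℤ) [K.IsStrictlyGE n]
  (hX : ∀ i, P (K.X i)) (hH : ∀ i, P (K.homology i))

include hP hX in
lemma image_toCycles (i j : ℤ) (hij : i + 1 = j) (hZ : P (K.cycles i)) :
    P (image (K.toCycles i j)) :=
  hP.cokernel (shortExact_iCycles_factorThruImage_toCycles K (by simpa using hij)) hZ (hX i)

include hP n hX hH in
lemma cycles (i : ℤ) : P (K.cycles i) := by
  suffices h : ∀ (k : ℕ) (i : ℤ), i < n + k → P (K.cycles i) from
    h (i - n + 1).toNat i (by lia)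
  intro k
  induction k with
  | zero =>
    intro i hi
    exact hP.of_isZero (.of_mono (K.iCycles i) (K.isZero_of_isStrictlyGE n i (by simpa using hi)))
  | succ k ih =>
    intro i hi
    exact hP.extension (shortExact_imageι_toCycles_homologyπ K (i := i - 1) (by simp))
      (hP.image_toCycles K hX _ i (by simp) (ih _ (by lia))) (hH i)

variable [Abelian D] [T.Additive] [PreservesFiniteLimits T]

include hP n hX hH in
lemma preservesLeftHomologyOf_sc (i : ℤ) :
    T.PreservesLeftHomologyOf (K.sc i) := by
  obtain ⟨j, hj⟩ : ∃ j, (ComplexShape.up ℤ).prev i = j := ⟨_, rfl⟩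
  have hji : j + 1 = i := by simp [← hj]
  have hZ : P (K.cycles j) := hP.cycles K n hX hH j
  have : Epi (T.map (factorThruImage (K.toCycles ((ComplexShape.up ℤ).prev i) i))) :=
    hj ▸ hP.epi_map (shortExact_iCycles_factorThruImage_toCycles K (by simpa using hji)) hZ
  have : Epi (T.map (K.homologyπ i)) :=
    hP.epi_map (shortExact_imageι_toCycles_homologyπ K hj) (hP.image_toCycles K hX j i hji hZ)
  exact preservesLeftHomologyOf_sc_of_epi_map K T i

include hP n hX in
lemma acyclic_map (hK : K.Acyclic) :
    ((T.mapHomologicalComplex (ComplexShape.up ℤ)).obj K).Acyclic := by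
  intro i
  have hH (i : ℤ) : IsZero (K.homology i) := (hK i).isZero_homology
  have := hP.preservesLeftHomologyOf_sc K n hX (fun i ↦ hP.of_isZero (hH i)) i
  rw [HomologicalComplex.exactAt_iff_isZero_homology]
  exact (T.map_isZero (hH i)).of_iso ((K.sc i).mapHomologyIso T)

include hP n hX hH in
lemma quasiIso_mapHomologicalComplex_app {T' : C ⥤ D} [T'.Additive]
    [T'.PreservesHomology] (τ : T ⟶ T') (hτ : ∀ i, IsIso (τ.app (K.homology i))) :
    QuasiIso ((NatTrans.mapHomologicalComplex τ (ComplexShape.up ℤ)).app K) := by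
  refine ⟨fun i ↦ ?_⟩
  have := hP.preservesLeftHomologyOf_sc K n hX hH i
  let h := (K.sc i).homologyData.left
  have : IsIso (τ.app h.H) := (NatTrans.isIso_app_iff_of_iso τ h.homologyIso).1 (hτ i)
  let e : T.obj h.H ≅ T'.obj h.H := asIso (τ.app h.H)
  rw [quasiIsoAt_iff_isIso_homologyMap]
  change IsIso (ShortComplex.homologyMap ((K.sc i).mapNatTrans τ))
  rw [(ShortComplex.LeftHomologyMapData.natTransApp h τ).homologyMap_eq]
  exact ((h.map T).homologyIso ≪≫ e ≪≫ (h.map T').homologyIso.symm).isIso_hom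

end

end IsAdaptedTo

end AdaptedClasses

section MappingCone

variable {C : Type u₁} [Category.{v₁} C] [Abelian C]

lemma quasiIso_iff_acyclic_mappingCone {K L : CochainComplex C ℤ} (f : K ⟶ L) :
    QuasiIso f ↔ HomologicalComplex.Acyclic (CochainComplex.mappingCone f) := by
  rw [← HomologicalComplex.mem_quasiIso_iff, ← HomotopyCategory.quotient_map_mem_quasiIso_iff,
    HomotopyCategory.quasiIso_eq_trW_subcategoryAcyclic]
  exact ((HomotopyCategory.subcategoryAcyclic C).trW_iff_of_distinguished _
    (HomotopyCategory.mappingCone_triangleh_distinguished f)).trans <|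
      HomotopyCategory.quotient_obj_mem_subcategoryAcyclic_iff_acyclic _

end MappingCone

namespace IsAdaptedTo

variable {C : Type u₁} [Category.{v₁} C] [Abelian C] {D : Type u₂} [Category.{v₂} D] [Abelian D]
  {P : ObjectProperty C} {T : C ⥤ D} [T.Additive] [PreservesFiniteLimits T]

lemma quasiIso_map (hP : IsAdaptedTo P T) {K L : CochainComplex C ℤ} (f : K ⟶ L) (a b : ℤ)
    [K.IsStrictlyGE a] [L.IsStrictlyGE b] (hK : ∀ i, P (K.X i)) (hL : ∀ i, P (L.X i))
    [QuasiIso f] : QuasiIso ((T.mapHomologicalComplex (ComplexShape.up ℤ)).map f) := by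
  have := CochainComplex.isStrictlyGE_mappingCone f a b (min (a - 1) b) (by simp) (by simp)
  have hcone (i : ℤ) : P ((CochainComplex.mappingCone f).X i) :=
    hP.of_iso (HomologicalComplex.homotopyCofiber.XIsoBiprod f i (i + 1) rfl).symm
      (hP.biprod (hK _) (hL _))
  have hT := hP.acyclic_map _ (min (a - 1) b) hcone ((quasiIso_iff_acyclic_mappingCone f).1 ‹_›)
  rw [quasiIso_iff_acyclic_mappingCone]
  exact fun i ↦ (hT i).of_iso (CochainComplex.mappingCone.mapHomologicalComplexIso f T)

lemma quasiIso_mapHomotopyCategoryPlus_map (hP : IsAdaptedTo P T) {K L : HomotopyCategory.Plus C}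
    (f : K ⟶ L) (hK : ∀ i, P (K.obj.as.X i)) (hL : ∀ i, P (L.obj.as.X i))
    (hf : HomotopyCategory.Plus.quasiIso C f) :
    HomotopyCategory.Plus.quasiIso D (T.mapHomotopyCategoryPlus.map f) := by
  obtain ⟨⟨K : CochainComplex C ℤ⟩, hK'⟩ := K
  obtain ⟨⟨L : CochainComplex C ℤ⟩, hL'⟩ := L
  obtain ⟨f, rfl⟩ := ObjectProperty.homMk_surjective f
  obtain ⟨f : K ⟶ L, rfl⟩ := (HomotopyCategory.quotient _ _).map_surjective f
  obtain ⟨a, _⟩ := (HomotopyCategory.plus_quotient_obj_iff K).1 hK'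
  obtain ⟨b, _⟩ := (HomotopyCategory.plus_quotient_obj_iff L).1 hL'
  rw [HomotopyCategory.Plus.quasiIso_iff] at hf ⊢
  have : QuasiIso f := (HomotopyCategory.quotient_map_mem_quasiIso_iff f).1 hf
  exact (HomotopyCategory.quotient_map_mem_quasiIso_iff _).2 (hP.quasiIso_map f a b hK hL)

lemma isIso_rightDerivedFunctorPlusUnit_app [EnoughInjectives C]
    [HasDerivedCategory.{w₁} C] [HasDerivedCategory.{w₂} D] (hP : IsAdaptedTo P T)
    (K : HomotopyCategory.Plus C) (hK : ∀ i, P (K.obj.as.X i)) :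
    IsIso (T.rightDerivedFunctorPlusUnit.app K) := by
  let r : (HomotopyCategory.Plus.localizerMorphism C).RightResolution K := Classical.arbitrary _
  let I := (HomotopyCategory.Plus.localizerMorphism C).functor.obj r.X₁
  have hI (i : ℤ) : P (I.obj.as.X i) :=
    have : Injective (I.obj.as.X i) := (r.X₁.obj.as.X i).property
    hP.of_injective _
  have : IsIso (T.rightDerivedFunctorPlusUnit.app I) :=
    inferInstanceAs (IsIso (T.rightDerivedFunctorPlusUnit.app
      ((HomotopyCategory.Plus.localizerMorphism C).functor.obj r.X₁)))
  have : IsIso (DerivedCategory.Plus.Qh.map r.w) :=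
    Localization.inverts _ (HomotopyCategory.Plus.quasiIso C) _ r.hw
  have : IsIso (DerivedCategory.Plus.Qh.map (T.mapHomotopyCategoryPlus.map r.w)) :=
    Localization.inverts _ (HomotopyCategory.Plus.quasiIso D) _
      (hP.quasiIso_mapHomotopyCategoryPlus_map r.w hK hI r.hw)
  have : IsIso (T.rightDerivedFunctorPlusUnit.app K ≫
      T.rightDerivedFunctorPlus.map (DerivedCategory.Plus.Qh.map r.w)) := by
    have h := T.rightDerivedFunctorPlusUnit.naturality r.w
    dsimp only [Functor.comp_map] at h
    rw [← h]
    infer_instance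
  exact IsIso.of_isIso_comp_right _
    (T.rightDerivedFunctorPlus.map (DerivedCategory.Plus.Qh.map r.w))

end IsAdaptedTo

lemma inducesEquivalence_of_isIso_unit_counit {C : Type u₁} [Category.{v₁} C] {D : Type u₂}
    [Category.{v₂} D] {C' : Type u₃} [Category.{v₃} C'] {D' : Type u₄} [Category.{v₄} D']
    {G : C ⥤ D} {F : D ⥤ C} (adj : G ⊣ F) {iC : C' ⥤ C} {iD : D' ⥤ D}
    (hC : iC.FullyFaithful) (hD : iD.FullyFaithful) {G' : C' ⥤ D'} {F' : D' ⥤ C'}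
    (α : G' ⋙ iD ≅ iC ⋙ G) (β : F' ⋙ iC ≅ iD ⋙ F)
    (hunit : ∀ X : C', IsIso (adj.unit.app (iC.obj X)))
    (hcounit : ∀ Y : D', IsIso (adj.counit.app (iD.obj Y))) :
    adj.InducesEquivalence iC iD := by
  let adj' : G' ⊣ F' := adj.restrictFullyFaithful hC hD α.symm β.symm
  have unit_eq (X : C') : iC.map (adj'.unit.app X) =
      adj.unit.app (iC.obj X) ≫ F.map (α.inv.app X) ≫ β.inv.app (G'.obj X) :=
    Adjunction.map_restrictFullyFaithful_unit_app ..
  have counit_eq (Y : D') : iD.map (adj'.counit.app Y) =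
      α.hom.app (F'.obj Y) ≫ G.map (β.hom.app Y) ≫ adj.counit.app (iD.obj Y) :=
    Adjunction.map_restrictFullyFaithful_counit_app ..
  have (X : C') : IsIso (adj'.unit.app X) :=
    have : IsIso (iC.map (adj'.unit.app X)) := by rw [unit_eq]; infer_instance
    hC.isIso_of_isIso_map _
  have (Y : D') : IsIso (adj'.counit.app Y) :=
    have : IsIso (iD.map (adj'.counit.app Y)) := by rw [counit_eq]; infer_instance
    hD.isIso_of_isIso_map _
  refine ⟨adj'.toEquivalence.symm, α, β, fun X ↦ ?_, fun Y ↦ ?_⟩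
  · change iC.map (adj'.unit.app X) ≫ β.hom.app (G'.obj X) = _
    rw [unit_eq, Category.assoc, Category.assoc, Iso.inv_hom_id_app]
    exact congrArg (adj.unit.app (iC.obj X) ≫ ·) (Category.comp_id _)
  · change G.map (β.inv.app Y) ≫ α.inv.app (F'.obj Y) ≫ iD.map (adj'.counit.app Y) = _
    rw [counit_eq, Iso.inv_hom_id_app_assoc, ← G.map_comp_assoc, Iso.inv_hom_id_app]
    exact (congrArg (· ≫ _) (G.map_id _)).trans (Category.id_comp _)

section HomotopyCategory

variable {C : Type u₁} [Category.{v₁} C] [Preadditive C]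
  {D : Type u₂} [Category.{v₂} D] [Preadditive D]
  {G : C ⥤ D} {F : D ⥤ C} [G.Additive] [F.Additive] (adj : G ⊣ F)

lemma mapHomotopyCategoryPlus_unit_app_hom (K : HomotopyCategory.Plus C) :
    (adj.mapHomotopyCategoryPlus.unit.app K).hom =
      (HomotopyCategory.quotient C _).map (adj.mapCochainComplex.unit.app K.obj.as) := by
  calc _ = adj.mapHomotopyCategory.unit.app K.obj ≫
        (F.mapHomotopyCategory _).map (𝟙 ((G.mapHomotopyCategory _).obj K.obj)) ≫ 𝟙 _ :=
        Adjunction.map_restrictFullyFaithful_unit_app adj.mapHomotopyCategory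
          (HomotopyCategory.Plus.fullyFaithfulι C) (HomotopyCategory.Plus.fullyFaithfulι D)
          (L := G.mapHomotopyCategoryPlus) (R := F.mapHomotopyCategoryPlus)
          (Iso.refl _) (Iso.refl _) K
    _ = _ := by
      rw [CategoryTheory.Functor.map_id, Category.comp_id]
      exact Category.comp_id _

lemma mapHomotopyCategoryPlus_counit_app_hom (K : HomotopyCategory.Plus D) :
    (adj.mapHomotopyCategoryPlus.counit.app K).hom =
      (HomotopyCategory.quotient D _).map (adj.mapCochainComplex.counit.app K.obj.as) := by
  calc _ = 𝟙 _ ≫ (G.mapHomotopyCategory _).map (𝟙 ((F.mapHomotopyCategory _).obj K.obj)) ≫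
        adj.mapHomotopyCategory.counit.app K.obj :=
        Adjunction.map_restrictFullyFaithful_counit_app adj.mapHomotopyCategory
          (HomotopyCategory.Plus.fullyFaithfulι C) (HomotopyCategory.Plus.fullyFaithfulι D)
          (L := G.mapHomotopyCategoryPlus) (R := F.mapHomotopyCategoryPlus)
          (Iso.refl _) (Iso.refl _) K
    _ = _ := by
      rw [CategoryTheory.Functor.map_id, Category.id_comp]
      exact Category.id_comp _

lemma isIso_mapHomotopyCategoryPlus_unit_app (hunit : ∀ X, IsIso (adj.unit.app X))
    (K : HomotopyCategory.Plus C) : IsIso (adj.mapHomotopyCategoryPlus.unit.app K) := by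
  have (i : ℤ) : IsIso ((adj.mapCochainComplex.unit.app K.obj.as).f i) := hunit (K.obj.as.X i)
  have : IsIso (adj.mapCochainComplex.unit.app K.obj.as) :=
    HomologicalComplex.Hom.isIso_of_components _
  have : IsIso ((HomotopyCategory.Plus.ι C).map (adj.mapHomotopyCategoryPlus.unit.app K)) := by
    rw [ObjectProperty.ι_map, mapHomotopyCategoryPlus_unit_app_hom]
    exact Functor.map_isIso (HomotopyCategory.quotient C _) (adj.mapCochainComplex.unit.app _)
  exact isIso_of_reflects_iso _ (HomotopyCategory.Plus.ι C)

end HomotopyCategory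

lemma quasiIso_mapHomotopyCategoryPlus_counit_app {C : Type u₁} [Category.{v₁} C] [Abelian C]
    {D : Type u₂} [Category.{v₂} D] [Abelian D] {G : C ⥤ D} {F : D ⥤ C} [G.Additive] [F.Additive]
    [PreservesFiniteLimits G] [PreservesFiniteColimits G] (adj : G ⊣ F) {P : ObjectProperty D}
    (hP : IsAdaptedTo P F) (K : HomotopyCategory.Plus D)
    (hK : ∀ i, P (K.obj.as.X i)) (hH : ∀ i, P (K.obj.as.homology i))
    (hcounit : ∀ i, IsIso (adj.counit.app (K.obj.as.homology i))) :
    HomotopyCategory.Plus.quasiIso D (adj.mapHomotopyCategoryPlus.counit.app K) := by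
  have := adj.rightAdjoint_preservesLimits
  obtain ⟨n, _⟩ := (HomotopyCategory.plus_quotient_obj_iff K.obj.as).1 K.property
  rw [HomotopyCategory.Plus.quasiIso_iff, mapHomotopyCategoryPlus_counit_app_hom]
  exact (HomotopyCategory.quotient_map_mem_quasiIso_iff _).2
    ((hP.comp G).quasiIso_mapHomologicalComplex_app K.obj.as n hK hH adj.counit hcounit)

section DerivedCategory

variable {C : Type u₁} [Category.{v₁} C] [Abelian C] [HasDerivedCategory.{w₁} C]
  {D : Type u₂} [Category.{v₂} D] [Abelian D] [HasDerivedCategory.{w₂} D]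

/-- The identification of the cohomology of a bounded below complex with that of its image in the
derived category. -/
def homologyQhObjIso (K : HomotopyCategory.Plus C) (n : ℤ) :
    (DerivedCategory.homologyFunctor C n).obj (DerivedCategory.Plus.Qh.obj K).obj ≅
      K.obj.as.homology n :=
  (DerivedCategory.homologyFunctorFactorsh C n).app K.obj ≪≫
    (HomotopyCategory.homologyFunctorFactors C (ComplexShape.up ℤ) n).app K.obj.as

lemma nonempty_homology_mapDerivedCategoryPlus_obj_iso (G : C ⥤ D) [G.Additive]
    [PreservesFiniteLimits G] [PreservesFiniteColimits G] (K : DerivedCategory.Plus C) (n : ℤ) :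
    Nonempty ((DerivedCategory.homologyFunctor D n).obj (G.mapDerivedCategoryPlus.obj K).obj ≅
      G.obj ((DerivedCategory.homologyFunctor C n).obj K.obj)) := by
  let K' := DerivedCategory.Plus.Qh.objPreimage K
  let e : DerivedCategory.Plus.Qh.obj K' ≅ K := DerivedCategory.Plus.Qh.objObjPreimageIso K
  let HC := DerivedCategory.Plus.ι ⋙ DerivedCategory.homologyFunctor C n
  let HD := DerivedCategory.Plus.ι ⋙ DerivedCategory.homologyFunctor D n
  exact ⟨HD.mapIso (G.mapDerivedCategoryPlus.mapIso e.symm ≪≫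
      G.mapDerivedCategoryPlusFactorsh.app K') ≪≫ homologyQhObjIso _ n ≪≫
    (K'.obj.as.sc n).mapHomologyIso G ≪≫
    G.mapIso ((homologyQhObjIso K' n).symm ≪≫ HC.mapIso e)⟩

lemma exists_injective_Qh_obj_iso [EnoughInjectives D] (L : DerivedCategory.Plus D) :
    ∃ (I : HomotopyCategory.Plus D) (_ : DerivedCategory.Plus.Qh.obj I ≅ L),
      ∀ i, Injective (I.obj.as.X i) :=
  let Φ := (InjectiveObject.ι D).mapHomotopyCategoryPlus ⋙ DerivedCategory.Plus.Qh
  ⟨(InjectiveObject.ι D).mapHomotopyCategoryPlus.obj (Φ.objPreimage L), Φ.objObjPreimageIso L,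
    fun i ↦ ((Φ.objPreimage L).obj.as.X i).property⟩

variable {G : C ⥤ D} {F : D ⥤ C} [G.Additive] [F.Additive]
    [PreservesFiniteLimits G] [PreservesFiniteColimits G] [EnoughInjectives D] (adj : G ⊣ F)

lemma derivedPlus_unit_app_Qh_obj (K : HomotopyCategory.Plus C) :
    adj.derivedPlus.unit.app (DerivedCategory.Plus.Qh.obj K) ≫
        F.rightDerivedFunctorPlus.map (G.mapDerivedCategoryPlusFactorsh.hom.app K) =
      DerivedCategory.Plus.Qh.map (adj.mapHomotopyCategoryPlus.unit.app K) ≫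
        F.rightDerivedFunctorPlusUnit.app (G.mapHomotopyCategoryPlus.obj K) :=
  have : (G.mapDerivedCategoryPlus ⋙ F.rightDerivedFunctorPlus).IsLeftDerivedFunctor
      ((Functor.associator _ _ _).inv ≫ Functor.whiskerRight G.mapDerivedCategoryPlusFactorsh.hom
        F.rightDerivedFunctorPlus) (HomotopyCategory.Plus.quasiIso C) :=
    Functor.isLeftDerivedFunctor_of_inverts _ _
      ((Functor.associator _ _ _).symm ≪≫ Functor.isoWhiskerRight G.mapDerivedCategoryPlusFactorsh
        F.rightDerivedFunctorPlus)
  adj.mapHomotopyCategoryPlus.derivedη_fac_app (HomotopyCategory.Plus.quasiIso C)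
    G.mapDerivedCategoryPlusFactorsh.hom F.rightDerivedFunctorPlusUnit K

lemma derivedPlus_counit_app_Qh_obj (K : HomotopyCategory.Plus D) :
    G.mapDerivedCategoryPlus.map (F.rightDerivedFunctorPlusUnit.app K) ≫
        adj.derivedPlus.counit.app (DerivedCategory.Plus.Qh.obj K) =
      G.mapDerivedCategoryPlusFactorsh.hom.app (F.mapHomotopyCategoryPlus.obj K) ≫
        DerivedCategory.Plus.Qh.map (adj.mapHomotopyCategoryPlus.counit.app K) :=
  have : (F.rightDerivedFunctorPlus ⋙ G.mapDerivedCategoryPlus).IsRightDerivedFunctor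
      (Functor.whiskerRight F.rightDerivedFunctorPlusUnit G.mapDerivedCategoryPlus ≫
        (Functor.associator _ _ _).hom) (HomotopyCategory.Plus.quasiIso D) :=
    (HomotopyCategory.Plus.localizerMorphism_derives _).isRightDerivedFunctor_of_isIso _
      (fun K ↦ inferInstanceAs (IsIso (G.mapDerivedCategoryPlus.map
        (F.rightDerivedFunctorPlusUnit.app
          ((HomotopyCategory.Plus.localizerMorphism D).functor.obj K)) ≫ 𝟙 _)))
  adj.mapHomotopyCategoryPlus.derivedε_fac_app (HomotopyCategory.Plus.quasiIso D)
    G.mapDerivedCategoryPlusFactorsh.hom F.rightDerivedFunctorPlusUnit K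

variable {P : ObjectProperty D}

lemma isIso_derivedPlus_unit_app (hP : IsAdaptedTo P F) (hG : ∀ X, P (G.obj X))
    (hunit : ∀ X, IsIso (adj.unit.app X)) (K : DerivedCategory.Plus C) :
    IsIso (adj.derivedPlus.unit.app K) := by
  have := adj.rightAdjoint_preservesLimits
  rw [← NatTrans.isIso_app_iff_of_iso _ (DerivedCategory.Plus.Qh.objObjPreimageIso K)]
  set K' := DerivedCategory.Plus.Qh.objPreimage K
  have := isIso_mapHomotopyCategoryPlus_unit_app adj hunit K'
  have : IsIso (F.rightDerivedFunctorPlusUnit.app (G.mapHomotopyCategoryPlus.obj K')) :=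
    hP.isIso_rightDerivedFunctorPlusUnit_app _ fun _ ↦ hG _
  have : IsIso (adj.derivedPlus.unit.app (DerivedCategory.Plus.Qh.obj K') ≫
      F.rightDerivedFunctorPlus.map (G.mapDerivedCategoryPlusFactorsh.hom.app K')) := by
    rw [derivedPlus_unit_app_Qh_obj adj K']
    infer_instance
  exact IsIso.of_isIso_comp_right _
    (F.rightDerivedFunctorPlus.map (G.mapDerivedCategoryPlusFactorsh.hom.app K'))

lemma isIso_derivedPlus_counit_app (hP : IsAdaptedTo P F) (L : DerivedCategory.Plus D)
    (hL : ∀ n, P ((DerivedCategory.homologyFunctor D n).obj L.obj))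
    (hcounit : ∀ n, IsIso (adj.counit.app ((DerivedCategory.homologyFunctor D n).obj L.obj))) :
    IsIso (adj.derivedPlus.counit.app L) := by
  obtain ⟨I, e, hI⟩ := exists_injective_Qh_obj_iso L
  let eH (n : ℤ) : (DerivedCategory.homologyFunctor D n).obj L.obj ≅ I.obj.as.homology n :=
    (DerivedCategory.Plus.ι ⋙ DerivedCategory.homologyFunctor D n).mapIso e.symm ≪≫
      homologyQhObjIso I n
  have hPI (i : ℤ) : P (I.obj.as.X i) := hP.of_injective _
  have := adj.rightAdjoint_preservesLimits
  have : IsIso (F.rightDerivedFunctorPlusUnit.app I) :=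
    hP.isIso_rightDerivedFunctorPlusUnit_app I hPI
  have : IsIso (DerivedCategory.Plus.Qh.map (adj.mapHomotopyCategoryPlus.counit.app I)) :=
    Localization.inverts _ (HomotopyCategory.Plus.quasiIso D) _ <|
      quasiIso_mapHomotopyCategoryPlus_counit_app adj hP I hPI
        (fun n ↦ hP.of_iso (eH n) (hL n))
        (fun n ↦ (NatTrans.isIso_app_iff_of_iso adj.counit (eH n)).1 (hcounit n))
  have : IsIso (G.mapDerivedCategoryPlus.map (F.rightDerivedFunctorPlusUnit.app I) ≫
      adj.derivedPlus.counit.app (DerivedCategory.Plus.Qh.obj I)) := by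
    rw [derivedPlus_counit_app_Qh_obj]
    infer_instance
  rw [← NatTrans.isIso_app_iff_of_iso _ e]
  exact IsIso.of_isIso_comp_left
    (G.mapDerivedCategoryPlus.map (F.rightDerivedFunctorPlusUnit.app I)) _

end DerivedCategory

section Stalks

lemma isIso_germ_of_isLeast {C : Type u₁} [Category.{u} C] [HasColimits C] {X : TopCat.{u}}
    (F : X.Presheaf C) {x : X} {W : Opens X} (hW : IsLeast {U : Opens X | x ∈ U} W) :
    IsIso (F.germ W x hW.1) :=
  let j : (OpenNhds x)ᵒᵖ := op ⟨W, hW.1⟩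
  have hj : IsTerminal j := IsTerminal.ofUniqueHom
    (fun U ↦ (homOfLE (hW.2 U.unop.2) : (⟨W, hW.1⟩ : OpenNhds x) ⟶ U.unop).op)
    (fun _ _ ↦ Subsingleton.elim _ _)
  isIso_ι_of_isTerminal hj ((OpenNhds.inclusion x).op ⋙ F)

lemma isIso_stalkFunctor_map_of_isLeast {C : Type u₁} [Category.{u} C] [HasColimits C]
    {X : TopCat.{u}} {F G : X.Presheaf C} (φ : F ⟶ G) {x : X} {W : Opens X}
    (hW : IsLeast {U : Opens X | x ∈ U} W) [IsIso (φ.app (op W))] :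
    IsIso ((TopCat.Presheaf.stalkFunctor C x).map φ) := by
  have := isIso_germ_of_isLeast F hW
  have : IsIso (F.germ W x hW.1 ≫ (TopCat.Presheaf.stalkFunctor C x).map φ) := by
    rw [TopCat.Presheaf.stalkFunctor_map_germ W x hW.1 φ]
    exact IsIso.comp_isIso' inferInstance (isIso_germ_of_isLeast G hW)
  exact IsIso.of_isIso_comp_left (F.germ W x hW.1) _

end Stalks

namespace ModSheaf

section Stalks

variable (R : Type u) [CommRing R] {X Y : TopCat.{u}}

/-- The stalk functor at `x` on sheaves of modules. -/
def stalk (x : X) : ModSheaf R X ⥤ ModuleCat.{u} R :=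
  TopCat.Sheaf.forget _ X ⋙ TopCat.Presheaf.stalkFunctor (ModuleCat.{u} R) x

/-- The natural map `Γ(U, -) ⟶ (-)_x` for `x ∈ U`. -/
def germ (U : Opens X) (x : X) (hx : x ∈ U) : sections R U ⟶ stalk R x where
  app F := F.presheaf.germ U x hx
  naturality _ _ φ := (TopCat.Presheaf.stalkFunctor_map_germ U x hx φ.hom).symm

variable {R} in
lemma isIso_of_isIso_stalk_map {F G : ModSheaf R X} (φ : F ⟶ G)
    (h : ∀ x, IsIso ((stalk R x).map φ)) : IsIso φ :=
  have (x : X) : IsIso ((TopCat.Presheaf.stalkFunctor (ModuleCat.{u} R) x).map φ.1) := h x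
  TopCat.Presheaf.isIso_of_stalkFunctor_map_iso φ

open scoped Classical in
/-- The functor that sends a module to the skyscraper sheaf at `x`. It is the right adjoint of
`stalk R x`, and is used to compare stalks with inverse images. -/
def skyscraper (x : X) : ModuleCat.{u} R ⥤ ModSheaf R X := skyscraperSheafFunctor x

open scoped Classical in
/-- The stalk at `x` is left adjoint to the skyscraper sheaf at `x`. -/
def stalkAdjunction (x : X) : stalk R x ⊣ skyscraper R x := stalkSkyscraperSheafAdjunction x

/-- The stalk of `f^* G` at `x` is the stalk of `G` at `f x`: both have the skyscraper sheaf at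
`f x` as right adjoint. -/
def stalkPullbackIso (f : X ⟶ Y) (x : X) : stalk R (f x) ≅ pullback R f ⋙ stalk R x :=
  (stalkAdjunction R (f x)).leftAdjointUniq ((adjunction R f).comp (stalkAdjunction R x))

/-- The sections of a skyscraper sheaf over an open neighborhood of its support. -/
def skyscraperSectionsIso (U : Opens X) (x : X) (hx : x ∈ U) :
    skyscraper R x ⋙ sections R U ≅ 𝟭 _ :=
  NatIso.ofComponents (fun M ↦ eqToIso (if_pos hx)) fun {M N} φ ↦ by
    have h : (sections R U).map ((skyscraper R x).map φ) = _ := dif_pos hx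
    refine (congrArg (· ≫ eqToHom (if_pos hx)) h).trans ?_
    exact (Category.assoc _ _ _).trans (congrArg _ ((Category.assoc _ _ _).trans
      ((congrArg _ (eqToHom_trans _ _)).trans (Category.comp_id _))))

lemma sections_map_stalkAdjunction_unit_app (U : Opens X) (x : X) (hx : x ∈ U)
    (F : ModSheaf R X) :
    (sections R U).map ((stalkAdjunction R x).unit.app F) ≫
      (skyscraperSectionsIso R U x hx).hom.app _ = (germ R U x hx).app F := by
  have h : (sections R U).map ((stalkAdjunction R x).unit.app F) =
      (germ R U x hx).app F ≫ 𝟙 _ ≫ eqToHom (if_pos hx).symm := dif_pos hx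
  refine (congrArg (· ≫ eqToHom (if_pos hx)) h).trans ?_
  exact (Category.assoc _ _ _).trans ((congrArg _ ((Category.assoc _ _ _).trans
    ((Category.id_comp _).trans (eqToHom_trans _ _)))).trans (Category.comp_id _))

lemma germ_comp_stalkPullbackIso_hom (f : X ⟶ Y) (U : Opens Y) (x : X) (hx : f x ∈ U)
    (G : ModSheaf R Y) :
    (germ R U (f x) hx).app G ≫ (stalkPullbackIso R f x).hom.app G =
      (sections R U).map ((adjunction R f).unit.app G) ≫
        (germ R ((Opens.map f).obj U) x hx).app ((pullback R f).obj G) := by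
  let sky := stalkAdjunction R x
  let sky' := stalkAdjunction R (f x)
  let e := skyscraperSectionsIso R U (f x) hx
  let θ := (stalkPullbackIso R f x).hom.app G
  calc (germ R U (f x) hx).app G ≫ θ
    _ = (sections R U).map (sky'.unit.app G) ≫ e.hom.app _ ≫ θ := by
      rw [← sections_map_stalkAdjunction_unit_app, Category.assoc]
    _ = (sections R U).map (sky'.unit.app G ≫ (skyscraper R (f x)).map θ) ≫ e.hom.app _ := by
      rw [Functor.map_comp, Category.assoc]
      exact congrArg _ (e.hom.naturality θ).symm
    _ = (sections R U).map ((adjunction R f).unit.app G ≫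
          (pushforward R f).map (sky.unit.app _)) ≫ e.hom.app _ :=
      congrArg ((sections R U).map · ≫ e.hom.app _)
        ((sky'.unit_leftAdjointUniq_hom_app ((adjunction R f).comp sky) G).trans
          (Adjunction.comp_unit_app _ _ _))
    _ = (sections R U).map ((adjunction R f).unit.app G) ≫
          (sections R ((Opens.map f).obj U)).map (sky.unit.app _) ≫
            (skyscraperSectionsIso R ((Opens.map f).obj U) x hx).hom.app _ :=
      (congrArg (· ≫ e.hom.app _) ((sections R U).map_comp _ _)).trans (Category.assoc _ _ _)
    _ = (sections R U).map ((adjunction R f).unit.app G) ≫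
          (germ R ((Opens.map f).obj U) x hx).app ((pullback R f).obj G) :=
      congrArg _ (sections_map_stalkAdjunction_unit_app R _ x hx _)

variable {R}

lemma isIso_adjunction_unit_app (f : X ⟶ Y) (hf : Function.Surjective f) {W : Y → Opens Y}
    (hW : ∀ y, IsLeast {U : Opens Y | y ∈ U} (W y)) (G : ModSheaf R Y)
    (hG : ∀ x, IsIso
      ((germ R ((Opens.map f).obj (W (f x))) x (hW (f x)).1).app ((pullback R f).obj G))) :
    IsIso ((adjunction R f).unit.app G) := by
  refine isIso_of_isIso_stalk_map _ fun y ↦ ?_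
  obtain ⟨x, rfl⟩ := hf y
  have hgerm : IsIso ((germ R (W (f x)) (f x) (hW (f x)).1).app G) :=
    isIso_germ_of_isLeast G.presheaf (hW (f x))
  have hsections : IsIso ((sections R (W (f x))).map ((adjunction R f).unit.app G)) := by
    have h := germ_comp_stalkPullbackIso_hom R f _ x (hW (f x)).1 G
    exact @IsIso.of_isIso_comp_right _ _ _ _ _ _ _ (hG x)
      (h ▸ IsIso.comp_isIso' hgerm inferInstance)
  exact @isIso_stalkFunctor_map_of_isLeast _ _ _ _ _ _
    ((adjunction R f).unit.app G).hom _ _ (hW (f x)) hsections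

lemma isIso_of_isIso_pushforward_map (f : X ⟶ Y) {F F' : ModSheaf R X} (φ : F ⟶ F')
    (U : X → Opens Y) (hU : ∀ x, f x ∈ U x)
    (hF : ∀ x, IsIso ((germ R ((Opens.map f).obj (U x)) x (hU x)).app F))
    (hF' : ∀ x, IsIso ((germ R ((Opens.map f).obj (U x)) x (hU x)).app F'))
    [IsIso ((pushforward R f).map φ)] : IsIso φ := by
  refine isIso_of_isIso_stalk_map φ fun x ↦ ?_
  let γ := germ R ((Opens.map f).obj (U x)) x (hU x)
  have hsections : IsIso ((sections R ((Opens.map f).obj (U x))).map φ) :=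
    inferInstanceAs (IsIso ((sections R (U x)).map ((pushforward R f).map φ)))
  have : IsIso (γ.app F ≫ (stalk R x).map φ) := by
    rw [← γ.naturality]
    exact IsIso.comp_isIso' hsections (hF' x)
  have := hF x
  exact IsIso.of_isIso_comp_left (γ.app F) _

lemma isIso_adjunction_counit_app (f : X ⟶ Y) (F : ModSheaf R X)
    [IsIso ((adjunction R f).unit.app ((pushforward R f).obj F))]
    (U : X → Opens Y) (hU : ∀ x, f x ∈ U x)
    (hF : ∀ x, IsIso ((germ R ((Opens.map f).obj (U x)) x (hU x)).app F))
    (hF' : ∀ x, IsIso ((germ R ((Opens.map f).obj (U x)) x (hU x)).app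
      ((pullback R f).obj ((pushforward R f).obj F)))) :
    IsIso ((adjunction R f).counit.app F) :=
  have : IsIso ((pushforward R f).map ((adjunction R f).counit.app F)) :=
    isIso_of_hom_comp_eq_id _ ((adjunction R f).right_triangle_components F)
  isIso_of_isIso_pushforward_map f _ U hU hF' hF

end Stalks

end ModSheaf

section ExtAcyclic

open Abelian

variable {C : Type u₁} [Category.{v₁} C] [Abelian C] [HasExt.{w} C]
  {D : Type u₂} [Category.{v₂} D]

lemma subsingleton_ext_of_isZero_rightDerived [EnoughInjectives C] [Abelian D] {L : D ⥤ C}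
    {T : C ⥤ D} [T.Additive] (adj : L ⊣ T) (M : D) [Projective M] (Y : C) (n : ℕ)
    (h : IsZero ((T.rightDerived (n + 1)).obj Y)) : Subsingleton (Ext (L.obj M) Y (n + 1)) := by
  refine subsingleton_of_forall_eq 0 fun α ↦ ?_
  let I := injectiveResolution Y
  obtain ⟨f, hf, rfl⟩ := I.extMk_surjective α (n + 2) rfl
  rw [I.extMk_eq_zero_iff f _ _ _ n rfl]
  have hexact : ((T.mapHomologicalComplex _).obj I.cocomplex).ExactAt (n + 1) := by
    rw [HomologicalComplex.exactAt_iff_isZero_homology]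
    exact h.of_iso (I.isoRightDerivedObj T (n + 1)).symm
  rw [HomologicalComplex.exactAt_iff' _ n (n + 1) (n + 2) (by simp) (by simp)] at hexact
  have hf' : adj.homEquiv _ _ f ≫ T.map (I.cocomplex.d (n + 1) (n + 2)) = 0 := by
    rw [← adj.homEquiv_naturality_right, hf, adj.homEquiv_unit, T.map_zero, comp_zero]
  let g : M ⟶ T.obj (I.cocomplex.X n) := hexact.liftFromProjective (adj.homEquiv _ _ f) hf'
  have hg : g ≫ T.map (I.cocomplex.d n (n + 1)) = adj.homEquiv _ _ f :=
    hexact.liftFromProjective_comp _ _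
  refine ⟨(adj.homEquiv _ _).symm g, (adj.homEquiv _ _).injective ?_⟩
  rw [adj.homEquiv_naturality_right, Equiv.apply_symm_apply, hg]

/-- The objects that are right orthogonal to a family `a` in all positive degrees: all `Y` with
`Extⁿ(a i, Y) = 0` for all `i` and all `n > 0`. -/
def extAcyclic {ι : Type*} (a : ι → C) : ObjectProperty C :=
  fun Y ↦ ∀ i (n : ℕ), Subsingleton (Ext (a i) Y (n + 1))

lemma hom_comp_surjective_of_subsingleton_ext (A : C) {S : ShortComplex C} (hS : S.ShortExact)
    [Subsingleton (Ext A S.X₁ 1)] : Function.Surjective (fun b : A ⟶ S.X₂ ↦ b ≫ S.g) := by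
  intro x
  obtain ⟨y, hy⟩ := Ext.covariant_sequence_exact₃ _ hS (Ext.mk₀ x) (zero_add 1)
    (Subsingleton.elim _ _)
  obtain ⟨b, rfl⟩ := Ext.homEquiv₀.symm.surjective y
  exact ⟨b, Ext.homEquiv₀.symm.injective (by simpa using hy)⟩

lemma isAdaptedTo_extAcyclic {ι : Type*} (a : ι → C) (T : C ⥤ D)
    (hT : ∀ {Y Z : C} (g : Y ⟶ Z),
      (∀ i, Function.Surjective (fun b : a i ⟶ Y ↦ b ≫ g)) → Epi (T.map g)) :
    IsAdaptedTo (extAcyclic a) T where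
  of_injective I _ i n := Ext.subsingleton_of_injective _ _ _
  extension {S} hS h₁ h₃ i n := subsingleton_of_forall_eq 0 fun x ↦ by
    have := h₁ i n
    have := h₃ i n
    obtain ⟨y, rfl⟩ := Ext.covariant_sequence_exact₂ _ hS x (Subsingleton.elim _ _)
    rw [Subsingleton.elim y 0, Ext.zero_comp]
  cokernel {S} hS h₁ h₂ i n := subsingleton_of_forall_eq 0 fun x ↦ by
    have := h₁ i (n + 1)
    have := h₂ i n
    obtain ⟨y, rfl⟩ := Ext.covariant_sequence_exact₃ _ hS x rfl (Subsingleton.elim _ _)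
    rw [Subsingleton.elim y 0, Ext.zero_comp]
  epi_map {S} hS h₁ := hT _ fun i ↦
    have := h₁ i 0
    hom_comp_surjective_of_subsingleton_ext (a i) hS

end ExtAcyclic

namespace ModSheaf

section Sections

variable (R : Type u) [CommRing R] {X : TopCat.{u}}

/-- The left adjoint of `Γ(U, -)`, which sends a module `M` to the extension by zero of the
constant sheaf on `U` with value `M`. -/
def sectionsLeftAdjoint (U : Opens X) : ModuleCat.{u} R ⥤ ModSheaf R X :=
  evaluationLeftAdjoint _ (op U) ⋙ presheafToSheaf _ _

/-- The functor `sectionsLeftAdjoint R U` is left adjoint to `Γ(U, -)`. -/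
def sectionsAdjunction (U : Opens X) : sectionsLeftAdjoint R U ⊣ sections R U :=
  (evaluationAdjunctionRight _ (op U)).comp (sheafificationAdjunction _ _)

/-- The sheaf that corepresents `Γ(U, -)`. -/
abbrev freeSheaf (U : Opens X) : ModSheaf R X := (sectionsLeftAdjoint R U).obj (ModuleCat.of R R)

variable {R}

lemma sections_map_surjective {F G : ModSheaf R X} (g : F ⟶ G) (U : Opens X)
    (hg : Function.Surjective (fun b : freeSheaf R U ⟶ F ↦ b ≫ g)) :
    Function.Surjective ((sections R U).map g) := by
  intro s
  let adj := sectionsAdjunction R U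
  let s' : ModuleCat.of R R ⟶ (sections R U).obj G :=
    ModuleCat.ofHom (LinearMap.toSpanSingleton R ((sections R U).obj G) s)
  obtain ⟨b, hb⟩ := hg ((adj.homEquiv _ _).symm s')
  have hb' : adj.homEquiv _ _ b ≫ (sections R U).map g = s' := by
    rw [← adj.homEquiv_naturality_right]
    exact (congrArg (adj.homEquiv _ _) hb).trans (Equiv.apply_symm_apply _ _)
  exact ⟨(adj.homEquiv _ _ b) (1 : R),
    (congrArg (fun φ ↦ φ.hom (1 : R)) hb').trans (one_smul R s)⟩

end Sections

section ConstantSheaves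

variable (R : Type u) [CommRing R] {X Y Z : TopCat.{u}}

/-- The inverse image along a composition is the composition of the inverse images. -/
def pullbackCompIso (f : X ⟶ Y) (g : Y ⟶ Z) :
    pullback R g ⋙ pullback R f ≅ pullback R (f ≫ g) :=
  ((adjunction R g).comp (adjunction R f)).leftAdjointUniq (adjunction R (f ≫ g))

/-- The constant sheaf functor is left adjoint to the global sections functor. -/
def constantAdjunction (X : TopCat.{u}) :
    constantSheaf (Opens.grothendieckTopology X) (ModuleCat.{u} R) ⊣ sections R (X := X) ⊤ :=
  constantSheafAdj _ _ isTerminalTop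

/-- The inverse image of a constant sheaf is constant, since `Γ(Y, f_* -) = Γ(X, -)`. -/
def constantSheafPullbackIso (f : X ⟶ Y) :
    constantSheaf (Opens.grothendieckTopology Y) (ModuleCat.{u} R) ⋙ pullback R f ≅
      constantSheaf (Opens.grothendieckTopology X) (ModuleCat.{u} R) :=
  ((constantAdjunction R Y).comp (adjunction R f)).leftAdjointUniq (constantAdjunction R X)

variable {R}

lemma IsConstant.of_iso {F G : ModSheaf R X} (hF : F.IsConstant) (e : F ≅ G) : G.IsConstant :=
  ⟨Functor.essImage.ofIso e hF.mem_essImage⟩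

lemma IsConstant.pullback_obj (f : X ⟶ Y) {G : ModSheaf R Y} (hG : G.IsConstant) :
    ((pullback R f).obj G).IsConstant := by
  obtain ⟨M, ⟨e⟩⟩ := hG.mem_essImage
  exact ⟨⟨M, ⟨(constantSheafPullbackIso R f).symm.app M ≪≫ (pullback R f).mapIso e⟩⟩⟩

lemma isConstant_of_isIso_stalk_map {M : ModuleCat.{u} R} {F : ModSheaf R X}
    (ψ : (Functor.const _).obj M ⟶ F.presheaf)
    (hψ : ∀ x, IsIso ((TopCat.Presheaf.stalkFunctor (ModuleCat.{u} R) x).map ψ)) :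
    F.IsConstant := by
  let J := Opens.grothendieckTopology X
  let K : X.Presheaf (ModuleCat.{u} R) := (Functor.const _).obj M
  let φ : (constantSheaf J (ModuleCat.{u} R)).obj M ⟶ F :=
    ObjectProperty.homMk (sheafifyLift J ψ F.2)
  have hφ : toSheafify J K ≫ φ.hom = ψ := toSheafify_sheafifyLift J ψ F.2
  have : IsIso φ := isIso_of_isIso_stalk_map φ fun x ↦ by
    let stalkFunctor := TopCat.Presheaf.stalkFunctor (ModuleCat.{u} R) x
    have hunit : IsIso (stalkFunctor.map (toSheafify J K)) :=
      TopCat.Presheaf.stalkFunctor_map_unit_toSheafify_isIso x (ModuleCat.{u} R) K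
    have hmap : stalkFunctor.map ψ = stalkFunctor.map (toSheafify J K) ≫ (stalk R x).map φ :=
      (congrArg stalkFunctor.map hφ.symm).trans (stalkFunctor.map_comp _ _)
    exact @IsIso.of_isIso_comp_left _ _ _ _ _ _ _ hunit (hmap ▸ hψ x)
  exact ⟨⟨M, ⟨asIso φ⟩⟩⟩

lemma isConstant_of_subsingleton [Subsingleton X] (F : ModSheaf R X) : F.IsConstant := by
  let s := coneOfDiagramInitial (initialOpOfTerminal isTerminalTop) F.presheaf
  refine isConstant_of_isIso_stalk_map s.π fun x ↦ ?_
  have hx : IsLeast {U : Opens X | x ∈ U} ⊤ := ⟨trivial, fun U hU y _ ↦ Subsingleton.elim x y ▸ hU⟩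
  have : IsIso (s.π.app (op ⊤)) :=
    inferInstanceAs (IsIso (F.presheaf.map (𝟙 _)))
  exact isIso_stalkFunctor_map_of_isLeast s.π hx

lemma isConstant_pullback_of_forall_eq (f : X ⟶ Y) (y : Y) (hf : ∀ x, f x = y)
    (G : ModSheaf R Y) : ((pullback R f).obj G).IsConstant := by
  let pt : TopCat.{u} := TopCat.of PUnit.{u + 1}
  let a : X ⟶ pt := TopCat.ofHom ⟨fun _ ↦ PUnit.unit, continuous_const⟩
  let b : pt ⟶ Y := TopCat.ofHom ⟨fun _ ↦ y, continuous_const⟩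
  obtain rfl : a ≫ b = f := by
    ext x
    exact (hf x).symm
  have : Subsingleton pt := inferInstanceAs (Subsingleton PUnit.{u + 1})
  exact ((isConstant_of_subsingleton ((pullback R b).obj G)).pullback_obj a).of_iso
    ((pullbackCompIso R a b).app G)

end ConstantSheaves

end ModSheaf

namespace Stratification

variable {X : TopCat.{u}} (S : Stratification X)

lemma toStratum_eq_of_mem (A : S.Stratum) {x : X} (hx : x ∈ A.1) : S.toStratum x = A :=
  Subtype.ext (S.eq_of_mem (S.toStratum x).2 A.2 (S.mem_toStratum x) hx)

lemma nonempty (A : S.Stratum) : A.1.Nonempty :=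
  Setoid.nonempty_of_mem_partition S.isPartition A.2

lemma proj_surjective : Function.Surjective S.proj := fun A ↦
  have ⟨x, hx⟩ := S.nonempty A
  ⟨x, S.toStratum_eq_of_mem A hx⟩

lemma mem_star_iff (A : S.Stratum) (x : X) : x ∈ S.star A ↔ A.1 ⊆ closure (S.toStratum x).1 :=
  ⟨fun ⟨B, ⟨hB, hAB⟩, hx⟩ ↦ by rwa [S.toStratum_eq_of_mem ⟨B, hB⟩ hx],
    fun hx ↦ ⟨_, ⟨(S.toStratum x).2, hx⟩, S.mem_toStratum x⟩⟩

/-- The smallest open neighborhood of a point of the space of strata. -/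
def minOpen (A : S.Stratum) : Opens S.space where
  carrier := {B : S.Stratum | A.1 ⊆ closure B.1}
  is_open' := by
    have h : S.toStratum ⁻¹' {B : S.Stratum | A.1 ⊆ closure B.1} = S.star A :=
      Set.ext fun x ↦ (S.mem_star_iff A x).symm
    exact isOpen_coinduced.2 (h ▸ (S.star A).isOpen)

lemma map_proj_obj_minOpen (A : S.Stratum) :
    (Opens.map S.proj).obj (S.minOpen A) = S.star A :=
  Opens.ext (Set.ext fun x ↦ (S.mem_star_iff A x).symm)

lemma isLeast_minOpen (A : S.Stratum) : IsLeast {U : Opens S.space | A ∈ U} (S.minOpen A) := by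
  refine ⟨subset_closure, fun U hA B hB ↦ ?_⟩
  obtain ⟨x, hx⟩ := S.nonempty A
  have hU : IsOpen (S.toStratum ⁻¹' U) := isOpen_coinduced.1 U.isOpen
  obtain ⟨y, hyU, hyB⟩ := mem_closure_iff.1 (hB hx) _ hU (by
    rwa [Set.mem_preimage, S.toStratum_eq_of_mem A hx])
  rwa [Set.mem_preimage, S.toStratum_eq_of_mem B hyB] at hyU

section Sheaves

variable {R : Type u} [CommRing R]

lemma weaklyConstructible_pullback (G : ModSheaf R S.space) :
    S.weaklyConstructible R ((ModSheaf.pullback R S.proj).obj G) := fun A ↦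
  (ModSheaf.isConstant_pullback_of_forall_eq (S.incl A ≫ S.proj) A
    (fun x ↦ S.toStratum_eq_of_mem A x.2) G).of_iso
    ((ModSheaf.pullbackCompIso R (S.incl A) S.proj).symm.app G)

lemma weaklyConstructible_of_iso {F G : ModSheaf R X} (hF : S.weaklyConstructible R F)
    (e : F ≅ G) : S.weaklyConstructible R G := fun A ↦
  (hF A).of_iso ((ModSheaf.pullback R (S.incl A)).mapIso e)

lemma epi_pushforward_map {F F' : ModSheaf R X} (g : F ⟶ F')
    (hg : ∀ A, Function.Surjective ((ModSheaf.sections R (S.star A)).map g)) :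
    Epi ((ModSheaf.pushforward R S.proj).map g) := by
  rw [← TopCat.Sheaf.isLocallySurjective_iff_epi, TopCat.Presheaf.isLocallySurjective_iff]
  intro U t A hA
  have h := hg A
  rw [← S.map_proj_obj_minOpen] at h
  exact ⟨S.minOpen A, (S.isLeast_minOpen A).2 hA, h _, (S.isLeast_minOpen A).1⟩

variable (R) in
/-- The sheaves without higher cohomology on stars. They are described by the vanishing of `Ext`,
as long exact sequences are available for `Ext`. -/
def starAcyclic [HasExt.{w} (ModSheaf R X)] : ObjectProperty (ModSheaf R X) :=
  extAcyclic fun A : S.Stratum ↦ ModSheaf.freeSheaf R (S.star A)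

lemma isAdaptedTo_starAcyclic [HasExt.{w} (ModSheaf R X)] :
    IsAdaptedTo (S.starAcyclic R) (ModSheaf.pushforward R S.proj) :=
  isAdaptedTo_extAcyclic _ _ fun g hg ↦
    S.epi_pushforward_map g fun A ↦ ModSheaf.sections_map_surjective g _ (hg A)

variable {S}

lemma IsAcyclicSheaf.starAcyclic [HasExt.{w} (ModSheaf R X)] {F : ModSheaf R X}
    (hF : S.IsAcyclicSheaf R F) : S.starAcyclic R F := fun A n ↦
  subsingleton_ext_of_isZero_rightDerived (ModSheaf.sectionsAdjunction R (S.star A))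
    (ModuleCat.of R R) F n (hF A (n + 1) n.succ_pos)

namespace IsAcyclic

variable (hS : S.IsAcyclic R)

include hS

lemma starAcyclic [HasExt.{w} (ModSheaf R X)] {F : ModSheaf R X}
    (hF : S.weaklyConstructible R F) : S.starAcyclic R F :=
  (hS.isAcyclicSheaf F hF).starAcyclic

lemma isIso_germ_minOpen {F : ModSheaf R X} (hF : S.weaklyConstructible R F) (x : X) :
    IsIso ((ModSheaf.germ R ((Opens.map S.proj).obj (S.minOpen (S.proj x))) x
      (S.isLeast_minOpen _).1).app F) := by
  have hgerm (U : Opens X) (hU : U = S.star (S.toStratum x)) (hx : x ∈ U) :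
      IsIso ((ModSheaf.germ R U x hx).app F) := by
    subst hU
    exact hS.isIso_germ F hF _ x (S.mem_toStratum x)
  exact hgerm _ (S.map_proj_obj_minOpen _) _

lemma isIso_unit_app (G : ModSheaf R S.space) :
    IsIso ((ModSheaf.adjunction R S.proj).unit.app G) :=
  ModSheaf.isIso_adjunction_unit_app S.proj S.proj_surjective S.isLeast_minOpen G
    (hS.isIso_germ_minOpen (S.weaklyConstructible_pullback G))

lemma isIso_counit_app {F : ModSheaf R X} (hF : S.weaklyConstructible R F) :
    IsIso ((ModSheaf.adjunction R S.proj).counit.app F) :=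
  have := hS.isIso_unit_app ((ModSheaf.pushforward R S.proj).obj F)
  ModSheaf.isIso_adjunction_counit_app S.proj F (fun x ↦ S.minOpen (S.proj x))
    (fun _ ↦ (S.isLeast_minOpen _).1) (hS.isIso_germ_minOpen hF)
    (hS.isIso_germ_minOpen (S.weaklyConstructible_pullback _))

end IsAcyclic

end Sheaves

section Derived

variable {R : Type u} [CommRing R] [HasDerivedCategory.{w₁} (ModSheaf R X)]
  [HasDerivedCategory.{w₂} (ModSheaf R S.space)]

lemma weaklyConstructiblePlus_pullbackPlus_obj (K : DerivedCategory.Plus (ModSheaf R S.space)) :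
    S.weaklyConstructiblePlus R ((S.pullbackPlus R).obj K) := fun n ↦
  have ⟨e⟩ := nonempty_homology_mapDerivedCategoryPlus_obj_iso (ModSheaf.pullback R S.proj) K n
  S.weaklyConstructible_of_iso (S.weaklyConstructible_pullback _) e.symm

lemma isLE_pullbackPlus_obj (K : DerivedCategory.Plus (ModSheaf R S.space)) (n : ℤ)
    (hK : K.obj.IsLE n) : ((S.pullbackPlus R).obj K).obj.IsLE n :=
  (DerivedCategory.isLE_iff _ _).2 fun i hi ↦
    have ⟨e⟩ := nonempty_homology_mapDerivedCategoryPlus_obj_iso (ModSheaf.pullback R S.proj) K i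
    (Functor.map_isZero _ ((DerivedCategory.isLE_iff _ _).1 hK i hi)).of_iso e

variable {S}

namespace IsAcyclic

variable (hS : S.IsAcyclic R)

include hS

lemma isIso_derivedAdjunction_unit_app (K : DerivedCategory.Plus (ModSheaf R S.space)) :
    IsIso ((S.derivedAdjunction R).unit.app K) := by
  have := hasExt_of_hasDerivedCategory.{w₁} (ModSheaf R X)
  exact isIso_derivedPlus_unit_app (ModSheaf.adjunction R S.proj) S.isAdaptedTo_starAcyclic
    (fun G ↦ hS.starAcyclic (S.weaklyConstructible_pullback G)) hS.isIso_unit_app K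

lemma isIso_derivedAdjunction_counit_app (L : DerivedCategory.Plus (ModSheaf R X))
    (hL : S.weaklyConstructiblePlus R L) : IsIso ((S.derivedAdjunction R).counit.app L) := by
  have := hasExt_of_hasDerivedCategory.{w₁} (ModSheaf R X)
  exact isIso_derivedPlus_counit_app (ModSheaf.adjunction R S.proj) S.isAdaptedTo_starAcyclic L
    (fun n ↦ hS.starAcyclic (hL n)) (fun n ↦ hS.isIso_counit_app (hL n))

lemma isLE_of_isLE_pullbackPlus_obj (K : DerivedCategory.Plus (ModSheaf R S.space)) (n : ℤ)
    (hK : ((S.pullbackPlus R).obj K).obj.IsLE n) : K.obj.IsLE n :=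
  (DerivedCategory.isLE_iff _ _).2 fun i hi ↦
    have ⟨e⟩ := nonempty_homology_mapDerivedCategoryPlus_obj_iso (ModSheaf.pullback R S.proj) K i
    have hpullback := ((DerivedCategory.isLE_iff _ _).1 hK i hi).of_iso e.symm
    have := hS.isIso_unit_app ((DerivedCategory.homologyFunctor _ i).obj K.obj)
    (Functor.map_isZero (ModSheaf.pushforward R S.proj) hpullback).of_iso
      (asIso ((ModSheaf.adjunction R S.proj).unit.app _))

lemma isLE_derivedPushforwardPlus_obj (L : DerivedCategory.Plus (ModSheaf R X))
    (hL : S.weaklyConstructiblePlus R L) (n : ℤ) (hn : L.obj.IsLE n) :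
    ((S.derivedPushforwardPlus R).obj L).obj.IsLE n :=
  have := hS.isIso_derivedAdjunction_counit_app L hL
  have : (DerivedCategory.Plus.ι.obj ((𝟭 _).obj L)).IsLE n := hn
  hS.isLE_of_isLE_pullbackPlus_obj _ n (DerivedCategory.TStructure.t.isLE_of_iso
    (DerivedCategory.Plus.ι.mapIso (asIso ((S.derivedAdjunction R).counit.app L))).symm n)

end IsAcyclic

variable (S R) in
/-- The functor `p^* : Dᵇ(S) ⥤ Dᵇ_{w,c}(X)`. -/
def pullbackBounded :
    DerivedCategory.Bounded (ModSheaf R S.space) ⥤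
      (S.weaklyConstructibleBounded R).FullSubcategory :=
  (S.weaklyConstructibleBounded R).lift
    (ObjectProperty.lift _ (DerivedCategory.boundedToPlus (ModSheaf R S.space) ⋙
      S.pullbackPlus R ⋙ DerivedCategory.Plus.ι) fun K ↦
        have ⟨n, hn⟩ := K.property.2
        ⟨((S.pullbackPlus R).obj _).property, n, S.isLE_pullbackPlus_obj _ n hn⟩)
    fun _ ↦ S.weaklyConstructiblePlus_pullbackPlus_obj _

/-- The functor `Rp_* : Dᵇ_{w,c}(X) ⥤ Dᵇ(S)` for an acyclic stratification. -/
def IsAcyclic.derivedPushforwardBounded (hS : S.IsAcyclic R) :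
    (S.weaklyConstructibleBounded R).FullSubcategory ⥤
      DerivedCategory.Bounded (ModSheaf R S.space) :=
  ObjectProperty.lift _ ((S.weaklyConstructibleBounded R).ι ⋙
    DerivedCategory.boundedToPlus (ModSheaf R X) ⋙ S.derivedPushforwardPlus R ⋙
      DerivedCategory.Plus.ι) fun L ↦
    have ⟨n, hn⟩ := L.obj.property.2
    ⟨((S.derivedPushforwardPlus R).obj _).property, n,
      hS.isLE_derivedPushforwardPlus_obj (.mk L.obj.obj L.obj.property.1) L.property n hn⟩

end Derived

end Stratification

end

theorem mainTheorem5 {X : TopCat.{u}} (S : Stratification X) (R : Type u) [CommRing R]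
    [HasDerivedCategory.{w₁} (ModSheaf R X)] [HasDerivedCategory.{w₂} (ModSheaf R S.space)]
    (hS : S.IsAcyclic R) :
    (S.derivedAdjunction R).InducesEquivalence
      (𝟭 (DerivedCategory.Plus (ModSheaf R S.space)))
      (S.weaklyConstructiblePlus R).ι ∧
    (S.derivedAdjunction R).InducesEquivalence
      (DerivedCategory.boundedToPlus (ModSheaf R S.space))
      ((S.weaklyConstructibleBounded R).ι ⋙ DerivedCategory.boundedToPlus (ModSheaf R X)) := by
  constructor
  · exact inducesEquivalence_of_isIso_unit_counit (S.derivedAdjunction R) (.id _)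
      (S.weaklyConstructiblePlus R).fullyFaithfulι
      (G' := (S.weaklyConstructiblePlus R).lift (S.pullbackPlus R)
        S.weaklyConstructiblePlus_pullbackPlus_obj)
      (F' := (S.weaklyConstructiblePlus R).ι ⋙ S.derivedPushforwardPlus R)
      (Iso.refl _) (Iso.refl _) hS.isIso_derivedAdjunction_unit_app
      (fun L ↦ hS.isIso_derivedAdjunction_counit_app L.obj L.property)
  · exact inducesEquivalence_of_isIso_unit_counit (S.derivedAdjunction R)
      (ObjectProperty.fullyFaithfulιOfLE _)
      ((S.weaklyConstructibleBounded R).fullyFaithfulι.comp (ObjectProperty.fullyFaithfulιOfLE _))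
      (G' := S.pullbackBounded R) (F' := hS.derivedPushforwardBounded)
      (Iso.refl _) (Iso.refl _) (fun K ↦ hS.isIso_derivedAdjunction_unit_app _)
      (fun L ↦ hS.isIso_derivedAdjunction_counit_app _ L.property)
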